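/- Let $\Sigma$ be a non-empty alphabet. A timed word over $\Sigma$ is a finite non-empty sequence $\rho=(\sigma_1,\tau_1)\cdots(\sigma_n,\tau_n)$ with $\sigma_i\in\Sigma$, $\tau_i\in\mathbb R$ and $0=\tau_1\le\tau_2\le\dots\le\tau_n$; it is strictly monotonic if $\tau_1<\dots<\tau_n$. *Metric logics.* For a set $\mathcal I$ of intervals of $[0,\infty)$ whose end points are natural numbers or $\infty$, the formulas of $\mathcal I\,\mathrm{MTL}[F,P]$ are built from $\top$ and the letters $a\in\Sigma$ with the Boolean connectives and the modalities $F_I$, $P_I$ ($I\in\mathcal I$), where $\rho,i\models a$ iff $\sigma_i=a$; $\rho,i\models F_I\varphi$ iff there is $j>i$ with $\tau_j-\tau_i\in I$ and $\rho,j\models\varphi$; and $\rho,i\models P_I\varphi$ iff there is $j<i$ with $\tau_i-\tau_j\in I$ and $\rho,j\models\varphi$. The formula $\varphi$ defines the language of all words $\rho$ with $\rho,1\models\varphi$. $\mathrm{BMTL}[F,P]$ is obtained by taking for $\mathcal I$ all bounded intervals (singular intervals $[c,c]$ included), and $\mathrm{MITL}[F,P]$ by taking all intervals (bounded or not) that are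 not of the form $[c,c]$. *Deterministic freeze logic.* Let $\mathcal X$ be a finite set of freeze variables. A timing constraint $g$ is a conjunction of constraints $x-T\approx c$ with $x\in\mathcal X$, $c\in\mathbb Z$, ${\approx}\in\{<,\le,>,\ge,=\}$; $\nu,t\models g$ means that $g$ holds when each $x$ has the value $\nu(x)$ and $T$ has the value $t$. A guarded event is a pair $\theta=(a,g)$, and $\rho,i,\nu\models\theta$ iff $\sigma_i=a$ and $\nu,\tau_i\models g$. The formulas of $\mathrm{TTL}[X_\theta,Y_\theta]$ are $$\varphi ::= \top\mid\theta\mid SP\,\varphi\mid EP\,\varphi\mid X_\theta\varphi\mid Y_\theta\varphi\mid x.\varphi\mid\varphi\vee\varphi\mid\neg\varphi .$$ Here $SP\,\varphi$ (resp. $EP\,\varphi$) evaluates $\varphi$ at the first (resp. last) position with the same valuation; $\rho,i,\nu\models X_\theta\varphi$ iff there is a position $j>i$ with $\rho,j,\nu\models\theta$, and $\rho,j,\nu\models\varphi$ for the least such $j$; $Y_\theta$ is the mirror image, with the greatest such $j<i$; and $\rho,i,\nu\models x.\varphi$ iff $\rho,i,\nu[x\mapsto\tau_i]\models\varphi$.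 The formula $\varphi$ defines the language of all $\rho$ with $\rho,1,\nu_0\models\varphi$, where $\nu_0(x)=0$ for all $x$. The finite set $\mathcal X$ may depend on the formula. For logics $\mathcal G_1,\mathcal G_2$ write $\mathcal G_1\subseteq\mathcal G_2$ if every language definable in $\mathcal G_1$ is definable in $\mathcal G_2$, and $\mathcal G_1\subsetneq\mathcal G_2$ if moreover $\mathcal G_2\not\subseteq\mathcal G_1$. **Theorem.** Over all (weakly monotonic) timed words, and likewise over strictly monotonic timed words only: 1. $\mathrm{BMTL}[F,P]\not\subseteq\mathrm{TTL}[X_\theta,Y_\theta]$; 2. $\mathrm{MITL}[F,P]\not\subseteq\mathrm{TTL}[X_\theta,Y_\theta]$; 3. $\mathrm{TTL}[X_\theta,Y_\theta]\subsetneq\mathrm{MITL}[F,P]$. -/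

import Mathlib

/-- A finite timed word over the alphabet `A` with weakly monotonic time, whose first time stamp
is `0` (so it has at least one event). The positions `1, …, #ρ` are the elements `0, …, len` of
`Fin (len + 1)`; in particular the first position is `0` and the last one is `Fin.last len`.
All time stamps are nonnegative by `time_zero` and `mono`. -/
structure TimedWord (A : Type*) where
  len : ℕ
  letter : Fin (len + 1) → A
  time : Fin (len + 1) → ℝ
  time_zero : time 0 = 0
  mono : Monotone time

namespace TimedWord

/-- The positions of a timed word. -/
abbrev Pos {A : Type*} (ρ : TimedWord A) : Type := Fin (ρ.len + 1)

/-- Strictly monotonic time. -/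
def IsStrict {A : Type*} (ρ : TimedWord A) : Prop := StrictMono ρ.time

end TimedWord

/-- Intervals of nonnegative reals whose end points are natural numbers or `∞`. -/
inductive TimeInterval : Type
  | Icc (a b : ℕ)
  | Ico (a b : ℕ)
  | Ioc (a b : ℕ)
  | Ioo (a b : ℕ)
  | Ici (a : ℕ)
  | Ioi (a : ℕ)

namespace TimeInterval

/-- The set of reals denoted by an interval. -/
def toSet : TimeInterval → Set ℝ
  | Icc a b => Set.Icc (a : ℝ) (b : ℝ)
  | Ico a b => Set.Ico (a : ℝ) (b : ℝ)
  | Ioc a b => Set.Ioc (a : ℝ) (b : ℝ)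
  | Ioo a b => Set.Ioo (a : ℝ) (b : ℝ)
  | Ici a => Set.Ici (a : ℝ)
  | Ioi a => Set.Ioi (a : ℝ)

/-- The interval does not extend to infinity. -/
def IsBounded : TimeInterval → Prop
  | Ici _ => False
  | Ioi _ => False
  | _ => True

/-- The interval is of the form `[c, c]`. -/
def IsSingular (I : TimeInterval) : Prop := ∃ c : ℕ, I = Icc c c

end TimeInterval

/-- Formulas of metric temporal logic with the modalities "until" and "since". -/
inductive MTLFormula (A : Type*)
  | top
  | atom (a : A)
  | neg (φ : MTLFormula A)
  | and (φ ψ : MTLFormula A)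
  | or (φ ψ : MTLFormula A)
  | until (I : TimeInterval) (φ ψ : MTLFormula A)
  | since (I : TimeInterval) (φ ψ : MTLFormula A)

namespace MTLFormula

/-- `φ.Sat ρ i` is `ρ, i ⊨ φ`, with the strict semantics of "until" and "since". -/
def Sat {A : Type*} (ρ : TimedWord A) : MTLFormula A → ρ.Pos → Prop
  | top, _ => True
  | atom a, i => ρ.letter i = a
  | neg φ, i => ¬ Sat ρ φ i
  | and φ ψ, i => Sat ρ φ i ∧ Sat ρ ψ i
  | or φ ψ, i => Sat ρ φ i ∨ Sat ρ ψ i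
  | .until I φ ψ, i => ∃ j, i < j ∧ Sat ρ ψ j ∧ ρ.time j - ρ.time i ∈ I.toSet ∧
      ∀ k, i < k → k < j → Sat ρ φ k
  | since I φ ψ, i => ∃ j, j < i ∧ Sat ρ ψ j ∧ ρ.time i - ρ.time j ∈ I.toSet ∧
      ∀ k, j < k → k < i → Sat ρ φ k

/-- The unary modality `F_I φ := ⊤ U_I φ`. -/
def future {A : Type*} (I : TimeInterval) (φ : MTLFormula A) : MTLFormula A := .until I top φ

/-- The unary modality `P_I φ := ⊤ S_I φ`. -/
def past {A : Type*} (I : TimeInterval) (φ : MTLFormula A) : MTLFormula A := .since I top φ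

/-- The fragment `𝓘 MTL[F, P]`: the only modalities are `F_I` and `P_I` with `I ∈ 𝓘`. -/
inductive IsUnary {A : Type*} (𝓘 : Set TimeInterval) : MTLFormula A → Prop
  | top : IsUnary 𝓘 top
  | atom (a : A) : IsUnary 𝓘 (atom a)
  | neg {φ : MTLFormula A} : IsUnary 𝓘 φ → IsUnary 𝓘 (neg φ)
  | and {φ ψ : MTLFormula A} : IsUnary 𝓘 φ → IsUnary 𝓘 ψ → IsUnary 𝓘 (and φ ψ)
  | or {φ ψ : MTLFormula A} : IsUnary 𝓘 φ → IsUnary 𝓘 ψ → IsUnary 𝓘 (or φ ψ)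
  | future {I : TimeInterval} {φ : MTLFormula A} :
      I ∈ 𝓘 → IsUnary 𝓘 φ → IsUnary 𝓘 (future I φ)
  | past {I : TimeInterval} {φ : MTLFormula A} :
      I ∈ 𝓘 → IsUnary 𝓘 φ → IsUnary 𝓘 (past I φ)

end MTLFormula

/-- The comparison symbols `<, ≤, >, ≥, =`. -/
inductive Comparison : Type
  | lt
  | le
  | gt
  | ge
  | eq

namespace Comparison

def Holds : Comparison → ℝ → ℝ → Prop
  | lt, r, s => r < s
  | le, r, s => r ≤ s
  | gt, r, s => r > s
  | ge, r, s => r ≥ s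
  | eq, r, s => r = s

end Comparison

/-- Timing constraints over the freeze variables `V`: conjunctions of constraints `x - T ≈ c`
with `c` an integer. -/
inductive TimingConstraint (V : Type*)
  | and (g₁ g₂ : TimingConstraint V)
  | diff (x : V) (r : Comparison) (c : ℤ)

namespace TimingConstraint

/-- `g.Sat ν t` is `ν, t ⊨ g`, where `t` is the value of `T`. -/
def Sat {V : Type*} (ν : V → ℝ) (t : ℝ) : TimingConstraint V → Prop
  | and g₁ g₂ => Sat ν t g₁ ∧ Sat ν t g₂
  | diff x r c => r.Holds (ν x - t) (c : ℝ)

end TimingConstraint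

/-- A guarded event `θ = (a, g)`. -/
structure GuardedEvent (A V : Type*) where
  event : A
  guard : TimingConstraint V

namespace GuardedEvent

/-- `θ.Sat ρ i ν` is `ρ, i, ν ⊨ θ`. -/
def Sat {A V : Type*} (ρ : TimedWord A) (θ : GuardedEvent A V) (i : ρ.Pos) (ν : V → ℝ) : Prop :=
  ρ.letter i = θ.event ∧ θ.guard.Sat ν (ρ.time i)

end GuardedEvent

/-- Formulas of the deterministic freeze logic `TTL[X_θ, Y_θ]` with freeze variables `V`;
`sp` and `ep` move to the first and to the last position. -/
inductive TTLFormula (A V : Type*)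
  | top
  | event (θ : GuardedEvent A V)
  | sp (φ : TTLFormula A V)
  | ep (φ : TTLFormula A V)
  | next (θ : GuardedEvent A V) (φ : TTLFormula A V)
  | prev (θ : GuardedEvent A V) (φ : TTLFormula A V)
  | freeze (x : V) (φ : TTLFormula A V)
  | or (φ ψ : TTLFormula A V)
  | neg (φ : TTLFormula A V)

namespace TTLFormula

/-- `φ.Sat ρ i ν` is `ρ, i, ν ⊨ φ`. -/
def Sat {A V : Type*} [DecidableEq V] (ρ : TimedWord A) :
    TTLFormula A V → ρ.Pos → (V → ℝ) → Prop
  | top, _, _ => True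
  | event θ, i, ν => θ.Sat ρ i ν
  | sp φ, _, ν => Sat ρ φ 0 ν
  | ep φ, _, ν => Sat ρ φ (Fin.last ρ.len) ν
  | next θ φ, i, ν => ∃ j, i < j ∧ θ.Sat ρ j ν ∧
      (∀ k, i < k → k < j → ¬ θ.Sat ρ k ν) ∧ Sat ρ φ j ν
  | prev θ φ, i, ν => ∃ j, j < i ∧ θ.Sat ρ j ν ∧
      (∀ k, j < k → k < i → ¬ θ.Sat ρ k ν) ∧ Sat ρ φ j ν
  | freeze x φ, i, ν => Sat ρ φ i (Function.update ν x (ρ.time i))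
  | or φ ψ, i, ν => Sat ρ φ i ν ∨ Sat ρ ψ i ν
  | neg φ, i, ν => ¬ Sat ρ φ i ν

end TTLFormula

/-- The languages, among the timed words in `W`, that are definable in `𝓘 MTL[F, P]`. -/
def mtlFPLanguages {A : Type*} (W : Set (TimedWord A)) (𝓘 : Set TimeInterval) :
    Set (Set (TimedWord A)) :=
  {L | ∃ φ : MTLFormula A, φ.IsUnary 𝓘 ∧ L = {ρ | ρ ∈ W ∧ φ.Sat ρ 0}}

/-- The languages definable in the bounded logic `BMTL[F, P]`. -/
def bmtlFPLanguages {A : Type*} (W : Set (TimedWord A)) : Set (Set (TimedWord A)) :=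
  mtlFPLanguages W {I | I.IsBounded}

/-- The languages definable in the non-punctual logic `MITL[F, P]`. -/
def mitlFPLanguages {A : Type*} (W : Set (TimedWord A)) : Set (Set (TimedWord A)) :=
  mtlFPLanguages W {I | ¬ I.IsSingular}

/-- The languages definable in `TTL[X_θ, Y_θ]` with some finite set of freeze variables, all of
which have the initial value `0`. -/
def ttlLanguages {A : Type*} (W : Set (TimedWord A)) : Set (Set (TimedWord A)) :=
  {L | ∃ (n : ℕ) (φ : TTLFormula A (Fin n)), L = {ρ | ρ ∈ W ∧ φ.Sat ρ 0 (fun _ => 0)}}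

/-!
The inclusion of `TTL[X_θ, Y_θ]` in `MITL[F, P]` holds because every position that a `TTL` formula
visits is uniquely determined. A `TTL` formula is translated together with `MITL` formulas that
pinpoint the current position and, for every freeze variable, the position whose time stamp it
stores. Relative to a pinpointed position `p`, the constraint `τ_p - τ_j ≈ c` at `j` only needs the
modalities `F_I` and `P_I` with `I` of the form `[c, ∞)` or `(c, ∞)`, because `p` is the only
position which they can find; the targets of `X_θ` and `Y_θ` are then pinpointed by Boolean
combinations of such formulas (`TTLFormula.sat_toMTL`).

For the two non-inclusions, determinism is a limitation: on a word over one letter, a formula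
reaches only positions close, in a sense depending on the formula, to the two ends. Suppose that
the time stamps of two words differ only at a position that is out of reach, and that guards over
reachable frozen values do not separate adjacent positions out of reach. Then `X_θ` and `Y_θ`
cannot jump into the middle of the unreachable zone, since the neighbour of the target would have
been found before; hence the formula does not separate the two words
(`TTLFormula.sat_congr_of_far`). The theorem is applied twice.

* For `BMTL[F, P]`, the events in `[0, 1)` are evenly spaced and those in `[1, 2)` are the same
  ones shifted by `1` and by half a spacing. Moving one event in the middle of the second half back
  by half a spacing creates two events at distance exactly `1`, as `F_[0,1] F_[1,1] ⊤` detects.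
* For `MITL[F, P]`, the events occur at the times `0, 1, …, n`. Moving one event in the middle back
  by `1 / 2` makes `F_[0,∞) F_(0,1) ⊤` true.
-/

/-! ### Translation of the freeze logic into `MITL[F, P]` -/

namespace MTLFormula

variable {A : Type*}

/-- `C` holds in `ρ` at position `i` and nowhere else. -/
def Pinpoints (ρ : TimedWord A) (C : MTLFormula A) (i : ρ.Pos) : Prop :=
  ∀ j, C.Sat ρ j ↔ j = i

/-- The formula `φ` holds at some position strictly after the present one. -/
def eventually (φ : MTLFormula A) : MTLFormula A := future (.Ici 0) φ

/-- The formula `φ` holds at some position strictly before the present one. -/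
def once (φ : MTLFormula A) : MTLFormula A := past (.Ici 0) φ

/-- The formula `φ` holds at some position. -/
def somewhere (φ : MTLFormula A) : MTLFormula A := or φ (or (eventually φ) (once φ))

/-- If `C` pinpoints `p`, this says at `j` that `τ_p - τ_j > c`. -/
def timeGt (C : MTLFormula A) (c : ℤ) : MTLFormula A :=
  if 0 ≤ c then future (.Ioi c.toNat) C else neg (past (.Ici (-c).toNat) C)

/-- If `C` pinpoints `p`, this says at `j` that `τ_p - τ_j ≥ c`. -/
def timeGe (C : MTLFormula A) (c : ℤ) : MTLFormula A :=
  if 0 < c then future (.Ici c.toNat) C else neg (past (.Ioi (-c).toNat) C)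

variable {ρ : TimedWord A}

theorem sat_future {I : TimeInterval} {φ : MTLFormula A} {i : ρ.Pos} :
    (future I φ).Sat ρ i ↔ ∃ j, i < j ∧ φ.Sat ρ j ∧ ρ.time j - ρ.time i ∈ I.toSet := by
  simp [future, Sat]

theorem sat_past {I : TimeInterval} {φ : MTLFormula A} {i : ρ.Pos} :
    (past I φ).Sat ρ i ↔ ∃ j, j < i ∧ φ.Sat ρ j ∧ ρ.time i - ρ.time j ∈ I.toSet := by
  simp [past, Sat]

theorem sat_eventually {φ : MTLFormula A} {i : ρ.Pos} :
    (eventually φ).Sat ρ i ↔ ∃ j, i < j ∧ φ.Sat ρ j := by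
  refine sat_future.trans (exists_congr fun j => ⟨fun h => ⟨h.1, h.2.1⟩, fun h => ⟨h.1, h.2, ?_⟩⟩)
  simpa [TimeInterval.toSet] using ρ.mono h.1.le

theorem sat_once {φ : MTLFormula A} {i : ρ.Pos} :
    (once φ).Sat ρ i ↔ ∃ j, j < i ∧ φ.Sat ρ j := by
  refine sat_past.trans (exists_congr fun j => ⟨fun h => ⟨h.1, h.2.1⟩, fun h => ⟨h.1, h.2, ?_⟩⟩)
  simpa [TimeInterval.toSet] using ρ.mono h.1.le

theorem sat_somewhere {φ : MTLFormula A} {i : ρ.Pos} :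
    (somewhere φ).Sat ρ i ↔ ∃ j, φ.Sat ρ j := by
  simp only [somewhere, Sat, sat_eventually, sat_once]
  constructor
  · rintro (h | ⟨j, -, h⟩ | ⟨j, -, h⟩) <;> exact ⟨_, h⟩
  · rintro ⟨j, h⟩
    rcases lt_trichotomy i j with hij | rfl | hij
    · exact .inr (.inl ⟨j, hij, h⟩)
    · exact .inl h
    · exact .inr (.inr ⟨j, hij, h⟩)

theorem Pinpoints.sat_future {C : MTLFormula A} {p : ρ.Pos} (h : Pinpoints ρ C p)
    {I : TimeInterval} {j : ρ.Pos} :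
    (future I C).Sat ρ j ↔ j < p ∧ ρ.time p - ρ.time j ∈ I.toSet := by
  simp [MTLFormula.sat_future, h _]

theorem Pinpoints.sat_past {C : MTLFormula A} {p : ρ.Pos} (h : Pinpoints ρ C p)
    {I : TimeInterval} {j : ρ.Pos} :
    (past I C).Sat ρ j ↔ p < j ∧ ρ.time j - ρ.time p ∈ I.toSet := by
  simp [MTLFormula.sat_past, h _]

theorem _root_.TimedWord.lt_of_time_lt {i j : ρ.Pos} (h : ρ.time i < ρ.time j) : i < j :=
  ρ.mono.reflect_lt h

theorem Pinpoints.sat_timeGt {C : MTLFormula A} {p : ρ.Pos} (h : Pinpoints ρ C p) (c : ℤ)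
    (j : ρ.Pos) : (timeGt C c).Sat ρ j ↔ (c : ℝ) < ρ.time p - ρ.time j := by
  unfold timeGt
  split_ifs with hc
  · lift c to ℕ using hc
    simp only [h.sat_future, TimeInterval.toSet, Int.toNat_natCast, Set.mem_Ioi, Int.cast_natCast]
    refine and_iff_right_of_imp fun hlt => TimedWord.lt_of_time_lt ?_
    have : (0 : ℝ) ≤ c := Nat.cast_nonneg c
    linarith
  · obtain ⟨d, rfl⟩ : ∃ d : ℕ, c = -(d : ℤ) := ⟨(-c).toNat, by omega⟩
    have hd : (0 : ℝ) < d := by exact_mod_cast (by omega : 0 < d)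
    simp only [Sat, h.sat_past, TimeInterval.toSet, neg_neg, Int.toNat_natCast, Set.mem_Ici]
    rw [and_iff_right_of_imp fun hle => TimedWord.lt_of_time_lt (by linarith)]
    push_cast
    rw [not_le]
    constructor <;> intro <;> linarith

theorem Pinpoints.sat_timeGe {C : MTLFormula A} {p : ρ.Pos} (h : Pinpoints ρ C p) (c : ℤ)
    (j : ρ.Pos) : (timeGe C c).Sat ρ j ↔ (c : ℝ) ≤ ρ.time p - ρ.time j := by
  unfold timeGe
  split_ifs with hc
  · obtain ⟨d, rfl⟩ : ∃ d : ℕ, c = (d : ℤ) := ⟨c.toNat, by omega⟩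
    have hd : (0 : ℝ) < d := by exact_mod_cast hc
    simp only [h.sat_future, TimeInterval.toSet, Int.toNat_natCast, Set.mem_Ici, Int.cast_natCast]
    exact and_iff_right_of_imp fun hle => TimedWord.lt_of_time_lt (by linarith)
  · obtain ⟨d, rfl⟩ : ∃ d : ℕ, c = -(d : ℤ) := ⟨(-c).toNat, by omega⟩
    have hd : (0 : ℝ) ≤ d := Nat.cast_nonneg d
    simp only [Sat, h.sat_past, TimeInterval.toSet, neg_neg, Int.toNat_natCast, Set.mem_Ioi]
    rw [and_iff_right_of_imp fun hlt => TimedWord.lt_of_time_lt (by linarith)]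
    push_cast
    rw [not_lt]
    constructor <;> intro <;> linarith

theorem pinpoints_first : Pinpoints ρ (neg (once top)) 0 := fun j => by
  simp only [Sat, sat_once, and_true, not_exists, not_lt]
  exact ⟨fun h => Fin.le_zero_iff.1 (h 0), fun h k => h ▸ Fin.zero_le k⟩

theorem pinpoints_last : Pinpoints ρ (neg (eventually top)) (Fin.last ρ.len) := fun j => by
  simp only [Sat, sat_eventually, and_true, not_exists, not_lt]
  exact ⟨fun h => Fin.last_le_iff.1 (h _), fun h k => h ▸ Fin.le_last k⟩

variable {φ : MTLFormula A}

theorem IsUnary.eventually (h : φ.IsUnary {I | ¬ I.IsSingular}) :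
    φ.eventually.IsUnary {I | ¬ I.IsSingular} :=
  .future (fun ⟨_, hc⟩ => nomatch hc) h

theorem IsUnary.once (h : φ.IsUnary {I | ¬ I.IsSingular}) :
    φ.once.IsUnary {I | ¬ I.IsSingular} :=
  .past (fun ⟨_, hc⟩ => nomatch hc) h

theorem IsUnary.somewhere (h : φ.IsUnary {I | ¬ I.IsSingular}) :
    φ.somewhere.IsUnary {I | ¬ I.IsSingular} :=
  h.or (h.eventually.or h.once)

theorem IsUnary.timeGt (h : φ.IsUnary {I | ¬ I.IsSingular}) (c : ℤ) :
    (φ.timeGt c).IsUnary {I | ¬ I.IsSingular} := by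
  unfold MTLFormula.timeGt
  split_ifs
  · exact .future (fun ⟨_, hc⟩ => nomatch hc) h
  · exact .neg (.past (fun ⟨_, hc⟩ => nomatch hc) h)

theorem IsUnary.timeGe (h : φ.IsUnary {I | ¬ I.IsSingular}) (c : ℤ) :
    (φ.timeGe c).IsUnary {I | ¬ I.IsSingular} := by
  unfold MTLFormula.timeGe
  split_ifs
  · exact .future (fun ⟨_, hc⟩ => nomatch hc) h
  · exact .neg (.past (fun ⟨_, hc⟩ => nomatch hc) h)

end MTLFormula

open MTLFormula (Pinpoints)

/-- If `C` pinpoints `p`, this says at `j` that `τ_p - τ_j ≈ c`. -/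
def Comparison.toMTL {A : Type*} (C : MTLFormula A) (c : ℤ) : Comparison → MTLFormula A
  | lt => .neg (C.timeGe c)
  | le => .neg (C.timeGt c)
  | gt => C.timeGt c
  | ge => C.timeGe c
  | eq => .and (C.timeGe c) (.neg (C.timeGt c))

theorem Comparison.sat_toMTL {A : Type*} {ρ : TimedWord A} {C : MTLFormula A} {p : ρ.Pos}
    (h : Pinpoints ρ C p) (c : ℤ) (r : Comparison) (j : ρ.Pos) :
    (r.toMTL C c).Sat ρ j ↔ r.Holds (ρ.time p - ρ.time j) c := by
  cases r <;>
    simp only [toMTL, MTLFormula.Sat, h.sat_timeGe, h.sat_timeGt, Holds, not_le, not_lt,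
      gt_iff_lt, ge_iff_le]
  exact ⟨fun h => le_antisymm h.2 h.1, fun h => ⟨h.ge, h.le⟩⟩

/-- The guard `g`, where `Ξ x` pinpoints a position whose time stamp is the value of `x`. -/
def TimingConstraint.toMTL {A V : Type*} (Ξ : V → MTLFormula A) :
    TimingConstraint V → MTLFormula A
  | and g₁ g₂ => .and (toMTL Ξ g₁) (toMTL Ξ g₂)
  | diff x r c => r.toMTL (Ξ x) c

/-- The guarded event `θ`, where `Ξ x` pinpoints a position whose time stamp is the value of
`x`. -/
def GuardedEvent.toMTL {A V : Type*} (Ξ : V → MTLFormula A) (θ : GuardedEvent A V) :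
    MTLFormula A :=
  .and (.atom θ.event) (θ.guard.toMTL Ξ)

/-- The first position after the one pinpointed by `C` at which `θ` holds. -/
def MTLFormula.firstAfter {A : Type*} (C θ : MTLFormula A) : MTLFormula A :=
  .and (.and θ (once C)) (.neg (once (.and θ (once C))))

/-- The last position before the one pinpointed by `C` at which `θ` holds. -/
def MTLFormula.lastBefore {A : Type*} (C θ : MTLFormula A) : MTLFormula A :=
  .and (.and θ (eventually C)) (.neg (eventually (.and θ (eventually C))))

/-- The translation of a `TTL` formula, where `C` pinpoints the current position and `Ξ x` a
position whose time stamp is the value of `x`. The position at which the translation is evaluated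
is irrelevant. -/
def TTLFormula.toMTL {A V : Type*} [DecidableEq V] :
    TTLFormula A V → MTLFormula A → (V → MTLFormula A) → MTLFormula A
  | top, _, _ => .top
  | event θ, C, Ξ => .somewhere (.and C (θ.toMTL Ξ))
  | sp φ, _, Ξ => toMTL φ (.neg (.once .top)) Ξ
  | ep φ, _, Ξ => toMTL φ (.neg (.eventually .top)) Ξ
  | next θ φ, C, Ξ =>
      .and (.somewhere (C.firstAfter (θ.toMTL Ξ))) (toMTL φ (C.firstAfter (θ.toMTL Ξ)) Ξ)
  | prev θ φ, C, Ξ =>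
      .and (.somewhere (C.lastBefore (θ.toMTL Ξ))) (toMTL φ (C.lastBefore (θ.toMTL Ξ)) Ξ)
  | freeze x φ, C, Ξ => toMTL φ C (Function.update Ξ x C)
  | or φ ψ, C, Ξ => .or (toMTL φ C Ξ) (toMTL ψ C Ξ)
  | neg φ, C, Ξ => .neg (toMTL φ C Ξ)

section Translation

variable {A V : Type*} {ρ : TimedWord A} {Ξ : V → MTLFormula A} {ν : V → ℝ}

theorem TimingConstraint.sat_toMTL (hΞ : ∀ x, ∃ p, Pinpoints ρ (Ξ x) p ∧ ν x = ρ.time p)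
    (g : TimingConstraint V) (j : ρ.Pos) : (g.toMTL Ξ).Sat ρ j ↔ g.Sat ν (ρ.time j) := by
  induction g with
  | and g₁ g₂ h₁ h₂ => simp only [toMTL, MTLFormula.Sat, Sat, h₁, h₂]
  | diff x r c =>
    obtain ⟨p, hp, hx⟩ := hΞ x
    simp only [toMTL, Sat, hx, Comparison.sat_toMTL hp]

theorem GuardedEvent.sat_toMTL (hΞ : ∀ x, ∃ p, Pinpoints ρ (Ξ x) p ∧ ν x = ρ.time p)
    (θ : GuardedEvent A V) (j : ρ.Pos) : (θ.toMTL Ξ).Sat ρ j ↔ θ.Sat ρ j ν := by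
  simp only [toMTL, MTLFormula.Sat, Sat, TimingConstraint.sat_toMTL hΞ]

theorem MTLFormula.Pinpoints.sat_firstAfter {C θ : MTLFormula A} {i : ρ.Pos}
    (h : Pinpoints ρ C i) (j : ρ.Pos) :
    (C.firstAfter θ).Sat ρ j ↔ i < j ∧ θ.Sat ρ j ∧ ∀ k, i < k → k < j → ¬ θ.Sat ρ k := by
  simp only [firstAfter, Sat, sat_once, h _, exists_eq_right]
  grind

theorem MTLFormula.Pinpoints.sat_lastBefore {C θ : MTLFormula A} {i : ρ.Pos}
    (h : Pinpoints ρ C i) (j : ρ.Pos) :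
    (C.lastBefore θ).Sat ρ j ↔ j < i ∧ θ.Sat ρ j ∧ ∀ k, j < k → k < i → ¬ θ.Sat ρ k := by
  simp only [lastBefore, Sat, sat_eventually, h _, exists_eq_right]
  grind

theorem MTLFormula.Pinpoints.firstAfter {C θ : MTLFormula A} {i j : ρ.Pos}
    (h : Pinpoints ρ C i) (hj : (C.firstAfter θ).Sat ρ j) : Pinpoints ρ (C.firstAfter θ) j := by
  refine fun k => ⟨fun hk => ?_, fun hk => hk ▸ hj⟩
  rw [h.sat_firstAfter] at hj hk
  rcases lt_trichotomy k j with hkj | hkj | hkj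
  · exact absurd hk.2.1 (hj.2.2 k hk.1 hkj)
  · exact hkj
  · exact absurd hj.2.1 (hk.2.2 j hj.1 hkj)

theorem MTLFormula.Pinpoints.lastBefore {C θ : MTLFormula A} {i j : ρ.Pos}
    (h : Pinpoints ρ C i) (hj : (C.lastBefore θ).Sat ρ j) : Pinpoints ρ (C.lastBefore θ) j := by
  refine fun k => ⟨fun hk => ?_, fun hk => hk ▸ hj⟩
  rw [h.sat_lastBefore] at hj hk
  rcases lt_trichotomy k j with hkj | hkj | hkj
  · exact absurd hj.2.1 (hk.2.2 j hkj hj.1)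
  · exact hkj
  · exact absurd hk.2.1 (hj.2.2 k hkj hk.1)

theorem TTLFormula.sat_toMTL [DecidableEq V] (φ : TTLFormula A V) {C : MTLFormula A} {Ξ : V → MTLFormula A}
    {i : ρ.Pos} {ν : V → ℝ} (hC : Pinpoints ρ C i)
    (hΞ : ∀ x, ∃ p, Pinpoints ρ (Ξ x) p ∧ ν x = ρ.time p) (k : ρ.Pos) :
    (φ.toMTL C Ξ).Sat ρ k ↔ φ.Sat ρ i ν := by
  induction φ generalizing C Ξ i ν with
  | top => simp only [toMTL, MTLFormula.Sat, Sat]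
  | event θ =>
    simp only [toMTL, MTLFormula.Sat, Sat, MTLFormula.sat_somewhere, GuardedEvent.sat_toMTL hΞ,
      hC _, exists_eq_left]
  | sp φ ih => exact ih MTLFormula.pinpoints_first hΞ
  | ep φ ih => exact ih MTLFormula.pinpoints_last hΞ
  | next θ φ ih =>
    simp only [toMTL, MTLFormula.Sat, Sat, MTLFormula.sat_somewhere]
    have key (j) := hC.sat_firstAfter (θ := θ.toMTL Ξ) j
    simp only [GuardedEvent.sat_toMTL hΞ] at key
    constructor
    · rintro ⟨⟨j, hj⟩, h⟩
      have := (key j).1 hj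
      exact ⟨j, this.1, this.2.1, this.2.2, (ih (hC.firstAfter hj) hΞ).1 h⟩
    · rintro ⟨j, h₁, h₂, h₃, h⟩
      have hj := (key j).2 ⟨h₁, h₂, h₃⟩
      exact ⟨⟨j, hj⟩, (ih (hC.firstAfter hj) hΞ).2 h⟩
  | prev θ φ ih =>
    simp only [toMTL, MTLFormula.Sat, Sat, MTLFormula.sat_somewhere]
    have key (j) := hC.sat_lastBefore (θ := θ.toMTL Ξ) j
    simp only [GuardedEvent.sat_toMTL hΞ] at key
    constructor
    · rintro ⟨⟨j, hj⟩, h⟩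
      have := (key j).1 hj
      exact ⟨j, this.1, this.2.1, this.2.2, (ih (hC.lastBefore hj) hΞ).1 h⟩
    · rintro ⟨j, h₁, h₂, h₃, h⟩
      have hj := (key j).2 ⟨h₁, h₂, h₃⟩
      exact ⟨⟨j, hj⟩, (ih (hC.lastBefore hj) hΞ).2 h⟩
  | freeze x φ ih =>
    refine ih hC fun y => ?_
    rcases eq_or_ne y x with rfl | hy
    · exact ⟨i, by simpa using hC, by simp⟩
    · simpa [hy] using hΞ y
  | or φ ψ ih₁ ih₂ => simp only [toMTL, MTLFormula.Sat, Sat, ih₁ hC hΞ, ih₂ hC hΞ]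
  | neg φ ih => simp only [toMTL, MTLFormula.Sat, Sat, ih hC hΞ]

theorem TimingConstraint.isUnary_toMTL (hΞ : ∀ x, (Ξ x).IsUnary {I | ¬ I.IsSingular})
    (g : TimingConstraint V) : (g.toMTL Ξ).IsUnary {I | ¬ I.IsSingular} := by
  induction g with
  | and g₁ g₂ h₁ h₂ => exact h₁.and h₂
  | diff x r c =>
    have h := hΞ x
    cases r
    · exact (h.timeGe c).neg
    · exact (h.timeGt c).neg
    · exact h.timeGt c
    · exact h.timeGe c
    · exact (h.timeGe c).and (h.timeGt c).neg

theorem TTLFormula.isUnary_toMTL [DecidableEq V] (φ : TTLFormula A V) {C : MTLFormula A} {Ξ : V → MTLFormula A}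
    (hC : C.IsUnary {I | ¬ I.IsSingular}) (hΞ : ∀ x, (Ξ x).IsUnary {I | ¬ I.IsSingular}) :
    (φ.toMTL C Ξ).IsUnary {I | ¬ I.IsSingular} := by
  have hθ {Ξ : V → MTLFormula A} (hΞ : ∀ x, (Ξ x).IsUnary {I | ¬ I.IsSingular})
      (θ : GuardedEvent A V) : (θ.toMTL Ξ).IsUnary {I | ¬ I.IsSingular} :=
    .and (.atom _) (θ.guard.isUnary_toMTL hΞ)
  induction φ generalizing C Ξ with
  | top => exact .top
  | event θ => exact (hC.and (hθ hΞ θ)).somewhere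
  | sp φ ih => exact ih MTLFormula.IsUnary.top.once.neg hΞ
  | ep φ ih => exact ih MTLFormula.IsUnary.top.eventually.neg hΞ
  | next θ φ ih =>
    have h := (hθ hΞ θ).and hC.once
    have h' := h.and h.once.neg
    exact h'.somewhere.and (ih h' hΞ)
  | prev θ φ ih =>
    have h := (hθ hΞ θ).and hC.eventually
    have h' := h.and h.eventually.neg
    exact h'.somewhere.and (ih h' hΞ)
  | freeze x φ ih =>
    refine ih hC fun y => ?_
    rcases eq_or_ne y x with rfl | hy
    · simpa using hC
    · simpa [hy] using hΞ y
  | or φ ψ ih₁ ih₂ => exact (ih₁ hC hΞ).or (ih₂ hC hΞ)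
  | neg φ ih => exact (ih hC hΞ).neg

end Translation

theorem ttlLanguages_subset_mitlFPLanguages {A : Type*} (W : Set (TimedWord A)) :
    ttlLanguages W ⊆ mitlFPLanguages W := by
  rintro _ ⟨n, φ, rfl⟩
  -- The initial value `0` of the freeze variables is the time stamp of the first position.
  refine ⟨φ.toMTL (.neg (.once .top)) fun _ => .neg (.once .top),
    φ.isUnary_toMTL MTLFormula.IsUnary.top.once.neg
      fun _ => MTLFormula.IsUnary.top.once.neg, ?_⟩
  ext ρ
  refine and_congr_right fun _ => (φ.sat_toMTL MTLFormula.pinpoints_first (fun _ => ?_) 0).symm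
  exact ⟨0, MTLFormula.pinpoints_first, ρ.time_zero.symm⟩

/-! ### Positions out of reach of a freeze formula -/

/-- The reals `u` and `v` compare in the same way with all integers of absolute value at most
`B`. -/
def SameComparisons (B : ℕ) (u v : ℝ) : Prop :=
  ∀ c : ℤ, c.natAbs ≤ B → (u < c ↔ v < c) ∧ ((c : ℝ) < u ↔ (c : ℝ) < v)

theorem SameComparisons.holds_iff {B : ℕ} {u v : ℝ} (h : SameComparisons B u v) {c : ℤ}
    (hc : c.natAbs ≤ B) (r : Comparison) : r.Holds u c ↔ r.Holds v c := by
  obtain ⟨h₁, h₂⟩ := h c hc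
  cases r <;> simp only [Comparison.Holds, gt_iff_lt, ge_iff_le]
  · exact h₁
  · rw [← not_lt, ← not_lt, h₂]
  · exact h₂
  · rw [← not_lt, ← not_lt, h₁]
  · rw [eq_iff_le_not_lt, eq_iff_le_not_lt, ← not_lt, ← not_lt, h₁, h₂]

/-- The largest absolute value of a constant in a timing constraint. -/
def TimingConstraint.bound {V : Type*} : TimingConstraint V → ℕ
  | and g₁ g₂ => max (bound g₁) (bound g₂)
  | diff _ _ c => c.natAbs

theorem TimingConstraint.sat_congr {V : Type*} {B : ℕ} {ν : V → ℝ} {s t : ℝ}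
    (h : ∀ x, SameComparisons B (ν x - s) (ν x - t)) (g : TimingConstraint V)
    (hg : g.bound ≤ B) : g.Sat ν s ↔ g.Sat ν t := by
  induction g with
  | and g₁ g₂ h₁ h₂ =>
    simp only [bound, max_le_iff] at hg
    simp only [Sat, h₁ hg.1, h₂ hg.2]
  | diff x r c => exact (h x).holds_iff hg r

namespace TTLFormula

/-- The largest absolute value of a constant in a formula. -/
def bound {A V : Type*} : TTLFormula A V → ℕ
  | top => 0
  | event θ => θ.guard.bound
  | sp φ => bound φ
  | ep φ => bound φ
  | next θ φ => max θ.guard.bound (bound φ)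
  | prev θ φ => max θ.guard.bound (bound φ)
  | freeze _ φ => bound φ
  | or φ ψ => max (bound φ) (bound ψ)
  | neg φ => bound φ

/-- The nesting depth of the modalities `X_θ` and `Y_θ`. The operators `SP` and `EP` do not count,
since they lead to the ends of the word. -/
def depth {A V : Type*} : TTLFormula A V → ℕ
  | top => 0
  | event _ => 0
  | sp φ => depth φ
  | ep φ => depth φ
  | next _ φ => depth φ + 1
  | prev _ φ => depth φ + 1
  | freeze _ φ => depth φ
  | or φ ψ => max (depth φ) (depth ψ)
  | neg φ => depth φ

/-- `Far d i` means that position `i` is out of reach of `d` nested modalities. If guards over the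
time stamps of positions that are not `Far d` neither separate the two words nor adjacent
positions one of which is `Far (d + 1)`, then `d` modalities do not separate the two words. -/
theorem sat_congr_of_far {A V : Type*} [DecidableEq V] {ρ : TimedWord A} {a : A}
    (hρ : ∀ i, ρ.letter i = a) {t : ρ.Pos → ℝ} (ht₀ : t 0 = 0) (ht : Monotone t)
    {B K : ℕ} {Far : ℕ → ρ.Pos → Prop} (h_anti : ∀ d i, Far (d + 1) i → Far d i)
    (h_first : ¬ Far 0 0) (h_last : ¬ Far 0 (Fin.last ρ.len))
    (h_adj : ∀ d (i j : ρ.Pos), (i.val + 1 = j ∨ j.val + 1 = i) → Far (d + 1) j → Far d i)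
    (h_time : ∀ d ≤ K, ∀ p, ¬ Far d p → ρ.time p = t p)
    (h_word : ∀ d ≤ K, ∀ p, ¬ Far d p → ∀ j,
      SameComparisons B (ρ.time p - ρ.time j) (ρ.time p - t j))
    (h_guard : ∀ d ≤ K, ∀ p, ¬ Far d p → ∀ i j : ρ.Pos, (i.val + 1 = j ∨ j.val + 1 = i) →
      Far (d + 1) j → SameComparisons B (ρ.time p - ρ.time j) (ρ.time p - ρ.time i))
    (φ : TTLFormula A V) (hφ : φ.bound ≤ B) {d : ℕ} (hd : d + φ.depth ≤ K) {i : ρ.Pos}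
    (hi : ¬ Far d i) {ν : V → ℝ} (hν : ∀ x, ∃ p, ¬ Far d p ∧ ν x = ρ.time p) :
    φ.Sat ρ i ν ↔ φ.Sat ⟨ρ.len, ρ.letter, t, ht₀, ht⟩ i ν := by
  have h_zero (d : ℕ) (i : ρ.Pos) (h : ¬ Far 0 i) : ¬ Far d i := by
    induction d with
    | zero => exact h
    | succ d ih => exact fun h' => ih (h_anti d i h')
  -- Guarded events do not separate the two words.
  have h_event {d : ℕ} (hd : d ≤ K) {ν : V → ℝ} (hν : ∀ x, ∃ p, ¬ Far d p ∧ ν x = ρ.time p)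
      {θ : GuardedEvent A V} (hθ : θ.guard.bound ≤ B) (j : ρ.Pos) :
      θ.Sat ρ j ν ↔ θ.Sat ⟨ρ.len, ρ.letter, t, ht₀, ht⟩ j ν :=
    and_congr_right fun _ => TimingConstraint.sat_congr (fun x => by
      obtain ⟨p, hp, hx⟩ := hν x
      exact hx ▸ h_word d hd p hp j) _ hθ
  have h_near {d : ℕ} (hd : d ≤ K) {ν : V → ℝ} (hν : ∀ x, ∃ p, ¬ Far d p ∧ ν x = ρ.time p)
      {θ : GuardedEvent A V} (hθ : θ.guard.bound ≤ B) {i j : ρ.Pos}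
      (hij : i.val + 1 = j ∨ j.val + 1 = i) (hj : Far (d + 1) j) (h : θ.Sat ρ j ν) :
      θ.Sat ρ i ν :=
    ⟨(hρ i).trans ((hρ j).symm.trans h.1), (TimingConstraint.sat_congr (fun x => by
      obtain ⟨p, hp, hx⟩ := hν x
      exact hx ▸ h_guard d hd p hp i j hij hj) _ hθ).1 h.2⟩
  induction φ generalizing d i ν with
  | top => exact Iff.rfl
  | event θ => exact h_event (by omega) hν hφ i
  | sp φ ih => exact ih hφ hd (h_zero _ _ h_first) hν
  | ep φ ih => exact ih hφ hd (h_zero _ _ h_last) hν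
  | next θ φ ih =>
    simp only [bound, max_le_iff] at hφ
    simp only [depth] at hd
    simp only [Sat, ← h_event (by omega : d ≤ K) hν hφ.1]
    refine exists_congr fun j => and_congr_right fun hij => and_congr_right fun hj =>
      and_congr_right fun hk => ih hφ.2 (by omega) (fun hfar => ?_)
        fun x => (hν x).imp fun p hp => ⟨fun h => hp.1 (h_anti d p h), hp.2⟩
    -- If the target `j` were far, then `θ` would already hold at its predecessor.
    have hij' : i.val < j.val := hij
    let k : ρ.Pos := ⟨j.val - 1, by omega⟩
    have hkj : k.val + 1 = j := Nat.sub_add_cancel (by omega)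
    have hik : i ≠ k := fun h => hi (h ▸ h_adj d k j (.inl hkj) hfar)
    refine hk k (lt_of_le_of_ne (Fin.le_def.2 (by omega)) hik) (Fin.lt_def.2 (by omega)) ?_
    exact h_near (by omega) hν hφ.1 (.inl hkj) hfar hj
  | prev θ φ ih =>
    simp only [bound, max_le_iff] at hφ
    simp only [depth] at hd
    simp only [Sat, ← h_event (by omega : d ≤ K) hν hφ.1]
    refine exists_congr fun j => and_congr_right fun hij => and_congr_right fun hj =>
      and_congr_right fun hk => ih hφ.2 (by omega) (fun hfar => ?_)
        fun x => (hν x).imp fun p hp => ⟨fun h => hp.1 (h_anti d p h), hp.2⟩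
    have hij' : j.val < i.val := hij
    let k : ρ.Pos := ⟨j.val + 1, by omega⟩
    have hkj : j.val + 1 = k := rfl
    have hik : k ≠ i := fun h => hi (h ▸ h_adj d k j (.inr hkj) hfar)
    refine hk k (Fin.lt_def.2 (by omega)) (lt_of_le_of_ne (Fin.le_def.2 (by omega)) hik) ?_
    exact h_near (by omega) hν hφ.1 (.inr hkj) hfar hj
  | freeze x φ ih =>
    simp only [Sat]
    rw [← h_time d (by omega) i hi]
    refine ih hφ hd hi fun y => ?_
    rcases eq_or_ne y x with rfl | hy
    · exact ⟨i, hi, by simp⟩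
    · simpa [hy] using hν y
  | or φ ψ ih₁ ih₂ =>
    simp only [bound, max_le_iff] at hφ
    simp only [depth] at hd
    exact or_congr (ih₁ hφ.1 (by omega) hi hν) (ih₂ hφ.2 (by omega) hi hν)
  | neg φ ih => exact not_congr (ih hφ hd hi hν)

end TTLFormula

/-! ### Words with rational time stamps -/

/-- The word of length `n + 1` over the letter `a` whose time stamps are `τ i / D`. -/
noncomputable def tickWord {A : Type*} (a : A) (n : ℕ) (D : ℕ) (τ : ℕ → ℤ) (h₀ : τ 0 = 0)
    (hτ : StrictMono τ) : TimedWord A where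
  len := n
  letter _ := a
  time i := (τ i : ℝ) / D
  time_zero := by simp [h₀]
  mono := fun i j hij => by
    have : (τ i : ℝ) ≤ τ j := by exact_mod_cast hτ.monotone hij
    exact div_le_div_of_nonneg_right this D.cast_nonneg

section Ticks

variable {A : Type*} {a : A} {n D : ℕ} {τ : ℕ → ℤ} {h₀ : τ 0 = 0} {hτ : StrictMono τ}

theorem tickWord_isStrict (hD : 0 < D) : (tickWord a n D τ h₀ hτ).IsStrict := fun i j hij => by
  have : (τ i : ℝ) < τ j := by exact_mod_cast hτ hij
  exact div_lt_div_of_pos_right this (by exact_mod_cast hD)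

theorem ticks_sub_lt_iff (hD : 0 < D) (r s c : ℤ) : (r : ℝ) / D - s / D < c ↔ r - s < c * D := by
  rw [← sub_div, div_lt_iff₀ (by exact_mod_cast hD)]
  exact_mod_cast Iff.rfl

theorem lt_ticks_sub_iff (hD : 0 < D) (r s c : ℤ) : (c : ℝ) < r / D - s / D ↔ c * D < r - s := by
  rw [← sub_div, lt_div_iff₀ (by exact_mod_cast hD)]
  exact_mod_cast Iff.rfl

theorem tickWord_sat_future_future_one (hD : 0 < D) :
    (MTLFormula.future (.Icc 0 1) (.future (.Icc 1 1) .top)).Sat (tickWord a n D τ h₀ hτ) 0 ↔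
      ∃ i j, 0 < i ∧ i < j ∧ j ≤ n ∧ τ i ≤ D ∧ τ j - τ i = D := by
  have hD' : (0 : ℝ) < D := by exact_mod_cast hD
  have h_eq (r s : ℤ) : (r : ℝ) / D - s / D ∈ TimeInterval.toSet (.Icc 1 1) ↔ r - s = D := by
    simp only [TimeInterval.toSet, Nat.cast_one, Set.Icc_self, Set.mem_singleton_iff]
    rw [← sub_div, div_eq_one_iff_eq hD'.ne']
    exact_mod_cast Iff.rfl
  have h_le (i : ℕ) (hi : 0 < i) :
      (τ i : ℝ) / D - τ 0 / D ∈ TimeInterval.toSet (.Icc 0 1) ↔ τ i ≤ D := by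
    have hτi : (0 : ℝ) ≤ τ i := by exact_mod_cast (h₀ ▸ hτ hi).le
    simp only [TimeInterval.toSet, Nat.cast_one, Nat.cast_zero, Set.mem_Icc, h₀, Int.cast_zero,
      zero_div, sub_zero, div_nonneg hτi hD'.le, true_and, div_le_one hD']
    exact_mod_cast Iff.rfl
  simp only [MTLFormula.sat_future]
  constructor
  · rintro ⟨i, hi, ⟨j, hij, -, hj⟩, hi'⟩
    exact ⟨i, j, hi, hij, j.is_le, (h_le i hi).1 hi', (h_eq _ _).1 hj⟩
  · rintro ⟨i, j, hi, hij, hj, hi', hj'⟩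
    exact ⟨⟨i, by simp only [tickWord]; omega⟩, hi,
      ⟨⟨j, by simp only [tickWord]; omega⟩, hij, trivial, (h_eq _ _).2 hj'⟩, (h_le i hi).2 hi'⟩

theorem tickWord_sat_future_future_lt_one (hD : 0 < D) :
    (MTLFormula.future (.Ici 0) (.future (.Ioo 0 1) .top)).Sat (tickWord a n D τ h₀ hτ) 0 ↔
      ∃ i j, 0 < i ∧ i < j ∧ j ≤ n ∧ τ j - τ i < D := by
  have h_lt (i j : ℕ) (hij : i < j) :
      (τ j : ℝ) / D - τ i / D ∈ TimeInterval.toSet (.Ioo 0 1) ↔ τ j - τ i < D := by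
    have h₁ := ticks_sub_lt_iff hD (τ j) (τ i) 1
    have h₂ := (lt_ticks_sub_iff hD (τ j) (τ i) 0).2 (by have := hτ hij; omega)
    rw [Int.cast_one, one_mul] at h₁
    rw [Int.cast_zero] at h₂
    simp only [TimeInterval.toSet, Nat.cast_one, Nat.cast_zero, Set.mem_Ioo, h₁, h₂, true_and]
  change (MTLFormula.eventually _).Sat _ _ ↔ _
  simp only [MTLFormula.sat_eventually, MTLFormula.sat_future]
  constructor
  · rintro ⟨i, hi, j, hij, -, hj⟩
    exact ⟨i, j, hi, hij, j.is_le, (h_lt i j hij).1 hj⟩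
  · rintro ⟨i, j, hi, hij, hj, hj'⟩
    exact ⟨⟨i, by simp only [tickWord]; omega⟩, hi,
      ⟨j, by simp only [tickWord]; omega⟩, hij, trivial, (h_lt i j hij).2 hj'⟩

/-- Two numbers strictly between consecutive integers compare equally with all integers. -/
theorem sameComparisons_of_mem_unit (hD : 0 < D) {B : ℕ} {r s s' : ℤ} (m : ℤ)
    (h₁ : m * D < r - s) (h₂ : r - s < (m + 1) * D) (h₃ : m * D < r - s')
    (h₄ : r - s' < (m + 1) * D) :
    SameComparisons B ((r : ℝ) / D - s / D) ((r : ℝ) / D - s' / D) := fun c _ => by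
  have hD' : (0 : ℤ) < D := by exact_mod_cast hD
  rw [ticks_sub_lt_iff hD, ticks_sub_lt_iff hD, lt_ticks_sub_iff hD, lt_ticks_sub_iff hD]
  rcases le_or_gt c m with h | h
  · have : c * D ≤ m * D := mul_le_mul_of_nonneg_right h hD'.le
    omega
  · have : (m + 1) * D ≤ c * D := mul_le_mul_of_nonneg_right h hD'.le
    omega

/-- Two numbers beyond all admissible constants, on the same side, compare equally with these. -/
theorem sameComparisons_of_large (hD : 0 < D) {B : ℕ} {r s s' : ℤ}
    (h : (B * D < r - s ∧ B * D < r - s') ∨ (B * D < s - r ∧ B * D < s' - r)) :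
    SameComparisons B ((r : ℝ) / D - s / D) ((r : ℝ) / D - s' / D) := fun c hc => by
  have hD' : (0 : ℤ) < D := by exact_mod_cast hD
  rw [ticks_sub_lt_iff hD, ticks_sub_lt_iff hD, lt_ticks_sub_iff hD, lt_ticks_sub_iff hD]
  have h₁ : c * D ≤ B * D := mul_le_mul_of_nonneg_right (by omega) hD'.le
  have h₂ : -(B : ℤ) * D ≤ c * D := mul_le_mul_of_nonneg_right (by omega) hD'.le
  rw [neg_mul] at h₂
  omega

/-- If, for all `B` and `K`, the formula `ψ` separates two words that satisfy the hypotheses of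
`TTLFormula.sat_congr_of_far`, then its language is not definable in `TTL[X_θ, Y_θ]`. -/
theorem not_mem_ttlLanguages {W : Set (TimedWord A)}
    (hW : W = Set.univ ∨ W = {ρ : TimedWord A | ρ.IsStrict}) (a : A) (ψ : MTLFormula A)
    (h : ∀ B K : ℕ, ∃ (n D : ℕ) (τ τ' : ℕ → ℤ) (h₀ : τ 0 = 0) (h₀' : τ' 0 = 0)
      (hτ : StrictMono τ) (hτ' : StrictMono τ') (Far : ℕ → ℕ → Prop),
      0 < D ∧ ¬ ψ.Sat (tickWord a n D τ h₀ hτ) 0 ∧ ψ.Sat (tickWord a n D τ' h₀' hτ') 0 ∧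
      (∀ d i, Far (d + 1) i → Far d i) ∧ ¬ Far 0 0 ∧ ¬ Far 0 n ∧
      (∀ d i j, (i + 1 = j ∨ j + 1 = i) → Far (d + 1) j → Far d i) ∧
      (∀ d ≤ K, ∀ p ≤ n, ¬ Far d p → τ p = τ' p) ∧
      (∀ d ≤ K, ∀ p ≤ n, ¬ Far d p → ∀ j ≤ n,
        SameComparisons B ((τ p : ℝ) / D - τ j / D) ((τ p : ℝ) / D - τ' j / D)) ∧
      (∀ d ≤ K, ∀ p ≤ n, ¬ Far d p → ∀ i ≤ n, ∀ j ≤ n, (i + 1 = j ∨ j + 1 = i) →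
        Far (d + 1) j → SameComparisons B ((τ p : ℝ) / D - τ j / D) ((τ p : ℝ) / D - τ i / D))) :
    {ρ | ρ ∈ W ∧ ψ.Sat ρ 0} ∉ ttlLanguages W := by
  rintro ⟨m, φ, hφ⟩
  obtain ⟨n, D, τ, τ', h₀, h₀', hτ, hτ', Far, hD, hψ, hψ', h_anti, h_first, h_last, h_adj, h_time,
    h_word, h_guard⟩ := h φ.bound φ.depth
  have hmem (τ h₀ hτ) : tickWord a n D τ h₀ hτ ∈ W := by
    rcases hW with rfl | rfl
    · trivial
    · exact tickWord_isStrict hD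
  have key := φ.sat_congr_of_far (ρ := tickWord a n D τ h₀ hτ) (a := a) (fun _ => rfl)
    (tickWord a n D τ' h₀' hτ').time_zero (tickWord a n D τ' h₀' hτ').mono
    (Far := fun d i => Far d i) (fun d i => h_anti d i) h_first h_last
    (fun d i j => h_adj d i j)
    (fun d hd p hp => congrArg (fun z : ℤ => (z : ℝ) / D) (h_time d hd p p.is_le hp))
    (fun d hd p hp j => h_word d hd p p.is_le hp j j.is_le)
    (fun d hd p hp i j => h_guard d hd p p.is_le hp i i.is_le j j.is_le) le_rfl
    (zero_add _).le (i := 0) h_first (ν := fun _ => 0)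
    (fun _ => ⟨0, h_first, (tickWord a n D τ h₀ hτ).time_zero.symm⟩)
  have hin : tickWord a n D τ' h₀' hτ' ∈ {ρ | ρ ∈ W ∧ ψ.Sat ρ 0} := ⟨hmem _ _ _, hψ'⟩
  rw [hφ] at hin
  have hin' : tickWord a n D τ h₀ hτ ∈ {ρ | ρ ∈ W ∧ ψ.Sat ρ 0} := by
    rw [hφ]
    exact ⟨hmem _ _ _, key.2 hin.2⟩
  exact hψ hin'.2

end Ticks

/-! ### The separating languages -/

theorem not_bmtlFPLanguages_subset {A : Type*} [Nonempty A] {W : Set (TimedWord A)}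
    (hW : W = Set.univ ∨ W = {ρ : TimedWord A | ρ.IsStrict}) :
    ¬ bmtlFPLanguages W ⊆ ttlLanguages W := by
  obtain ⟨a⟩ := ‹Nonempty A›
  have hI (b c : ℕ) : TimeInterval.Icc b c ∈ {I : TimeInterval | I.IsBounded} := trivial
  refine fun hsub => not_mem_ttlLanguages hW a
    (.future (.Icc 0 1) (.future (.Icc 1 1) .top)) (fun B K => ?_)
    (hsub ⟨_, .future (hI 0 1) (.future (hI 1 1) .top), rfl⟩)
  -- The unit of time has `2 * N` ticks and contains `N` events. With this `N`, the events with
  -- index `K + 2` in the two units, the second of which is moved, are `Far (K + 1)`.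
  obtain ⟨N, hN⟩ : ∃ N : ℕ, N = 2 * K + 5 := ⟨_, rfl⟩
  have hD : 0 < 2 * N := by omega
  refine ⟨2 * N - 1, 2 * N, fun i => if i < N then 2 * (i : ℤ) else 2 * i + 1,
    fun i => if i < N ∨ i = N + K + 2 then 2 * (i : ℤ) else 2 * i + 1, by simp; omega, by simp [hN],
    strictMono_nat_of_lt_succ fun i => by split_ifs <;> push_cast <;> omega,
    strictMono_nat_of_lt_succ fun i => by split_ifs <;> push_cast <;> omega,
    fun d i => (d < i ∧ i + d + 1 < N) ∨ (N + d < i ∧ i + d + 1 < 2 * N),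
    hD, ?_, ?_, by grind, by omega, by omega, by grind, ?_, ?_, ?_⟩
  · rw [tickWord_sat_future_future_one hD]
    rintro ⟨i, j, hi, hij, hj, -, h⟩
    push_cast at h
    split_ifs at h <;> omega
  · rw [tickWord_sat_future_future_one hD]
    refine ⟨K + 2, N + K + 2, by omega, by omega, by omega, ?_, ?_⟩
    · rw [if_pos (by omega)]
      omega
    · rw [if_pos (by omega), if_pos (by omega)]
      push_cast
      ring
  · intro d hd p hp hfar
    have : p ≠ N + K + 2 := by omega
    simp [this]
  · intro d hd p hp hfar j hj
    by_cases hjm : j = N + K + 2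
    · -- The moved event stays in an open unit interval relative to the time stamp of `p`.
      obtain ⟨m, hm⟩ : ∃ m : ℤ, m = if p < K + 2 then -2 else if p < N + K + 2 then -1 else 0 :=
        ⟨_, rfl⟩
      apply sameComparisons_of_mem_unit hD m <;>
      · push_cast
        split_ifs at hm ⊢ <;> subst hm <;> omega
    · simp only [hjm, or_false]
      exact fun _ _ => ⟨Iff.rfl, Iff.rfl⟩
  · intro d hd p hp hfar i hi j hj hij hfar'
    -- Both differences lie in the unit interval `(m, m + 1)`, which depends on the halves of the
    -- word that contain `p` and `j` and on the order of `p` and `j` within their halves.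
    obtain ⟨m, hm⟩ : ∃ m : ℤ, m = if j < N then (if p < j then -1 else if p < N + j then 0 else 1)
        else (if p + N < j then -2 else if p < j then -1 else 0) := ⟨_, rfl⟩
    apply sameComparisons_of_mem_unit hD m <;>
    · push_cast
      split_ifs at hm ⊢ <;> subst hm <;> omega

theorem not_mitlFPLanguages_subset {A : Type*} [Nonempty A] {W : Set (TimedWord A)}
    (hW : W = Set.univ ∨ W = {ρ : TimedWord A | ρ.IsStrict}) :
    ¬ mitlFPLanguages W ⊆ ttlLanguages W := by
  obtain ⟨a⟩ := ‹Nonempty A›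
  refine fun hsub => not_mem_ttlLanguages hW a
    (.future (.Ici 0) (.future (.Ioo 0 1) .top)) (fun B K => ?_)
    (hsub ⟨_, .future (fun ⟨_, hc⟩ => nomatch hc)
      (.future (fun ⟨_, hc⟩ => nomatch hc) .top), rfl⟩)
  -- Constants up to `B` let a modality move by less than `B + 2` positions beyond the positions
  -- reached before, so the middle position `M` is beyond the reach of `K + 1` modalities.
  obtain ⟨M, hM⟩ : ∃ M : ℕ, M = (K + 1) * (B + 2) + 2 := ⟨_, rfl⟩
  have hsucc (d : ℕ) : (d + 1) * (B + 2) = d * (B + 2) + (B + 2) := by ring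
  have hle (d : ℕ) (hd : d ≤ K) : d * (B + 2) + (B + 2) + 2 ≤ M := by
    have := Nat.mul_le_mul_right (B + 2) hd
    rw [hM, hsucc]
    omega
  have hM₂ : 2 ≤ M := by omega
  refine ⟨2 * M, 2, fun i => 2 * i, fun i => if i = M then 2 * i - 1 else 2 * i,
    by simp, by simp; omega,
    strictMono_nat_of_lt_succ fun i => by push_cast; omega,
    strictMono_nat_of_lt_succ fun i => by split_ifs <;> push_cast <;> omega,
    fun d i => d * (B + 2) < i ∧ i + d * (B + 2) < 2 * M,
    two_pos, ?_, ?_, ?_, by simp, by simp, ?_, ?_, ?_, ?_⟩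
  · rw [tickWord_sat_future_future_lt_one two_pos]
    rintro ⟨i, j, -, hij, -, h⟩
    push_cast at h
    omega
  · rw [tickWord_sat_future_future_lt_one two_pos]
    refine ⟨M - 1, M, by omega, by omega, by omega, ?_⟩
    rw [if_pos rfl, if_neg (by omega)]
    push_cast
    omega
  · intro d i
    simp only [hsucc]
    omega
  · intro d i j
    simp only [hsucc]
    omega
  · intro d hd p hp hfar
    have := hle d hd
    have : p ≠ M := by omega
    simp [this]
  · intro d hd p hp hfar j hj
    have := hle d hd
    by_cases hjm : j = M
    · apply sameComparisons_of_large two_pos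
      simp only [hjm, if_true]
      push_cast
      omega
    · simp only [hjm, if_false]
      exact fun _ _ => ⟨Iff.rfl, Iff.rfl⟩
  · intro d hd p hp hfar i hi j hj hij hfar'
    simp only [hsucc] at hfar hfar'
    apply sameComparisons_of_large two_pos
    push_cast
    omega

theorem mainTheorem7 {A : Type*} [Nonempty A] (W : Set (TimedWord A))
    (hW : W = Set.univ ∨ W = {ρ : TimedWord A | ρ.IsStrict}) :
    ¬ bmtlFPLanguages W ⊆ ttlLanguages W ∧
      ¬ mitlFPLanguages W ⊆ ttlLanguages W ∧
      ttlLanguages W ⊂ mitlFPLanguages W :=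
  ⟨not_bmtlFPLanguages_subset hW, not_mitlFPLanguages_subset hW,
    ttlLanguages_subset_mitlFPLanguages W, not_mitlFPLanguages_subset hW⟩
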